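/- For an open set $U\subseteq\mathbb{C}^n$ let $A^2(U)$ be the Bergman space, i.e. the Hilbert space of holomorphic functions on $U$ that are square integrable with respect to Lebesgue measure, with the $L^2(U)$ inner product $\langle\cdot,\cdot\rangle_U$, and let $K^U$ be its reproducing (Bergman) kernel, so that $K^U_z=K^U(\cdot,z)\in A^2(U)$ and $f(z)=\langle f,K^U_z\rangle_U$ for $f\in A^2(U)$, $z\in U$. For $z\in U$ with $K^U(z,z)\neq 0$ put $k^U_z=K^U_z/\sqrt{K^U(z,z)}$, and for a bounded linear operator $S$ on $A^2(U)$ define its Berezin transform by $B_US(z)=\langle Sk^U_z,k^U_z\rangle_U$. Let $\{\Omega_j\}_{j\ge 1}$ be a sequence of domains (nonempty connected open sets) in $\mathbb{C}^n$ such that $\Omega_j\subseteq\Omega_{j+1}$ for all $j$, and suppose that $\Omega=\bigcup_{j=1}^\infty\Omega_j$ satisfies $A^2(\Omega)\neq\{0\}$. Let $\mathcal{Z}=\{z\in\Omega: K^\Omega(z,z)=0\}$, let $R_{\Omega_j}:A^2(\Omega)\to A^2(\Omega_j)$, $R_{\Omega_j}f=f|_{\Omega_j}$, be the restriction operator, and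 let $R_{\Omega_j}^*:A^2(\Omega_j)\to A^2(\Omega)$ be its Hilbert space adjoint. Let $T$ be a bounded linear operator on $A^2(\Omega)$. Then $$B_{\Omega_j}\big(R_{\Omega_j}TR_{\Omega_j}^*\big)\to B_\Omega T\quad\text{as } j\to\infty$$ uniformly on every compact subset $K$ of $\Omega\setminus\mathcal{Z}$; here, for all sufficiently large $j$, one has $K\subseteq\Omega_j$ and $K^{\Omega_j}(z,z)\neq 0$ for all $z\in K$, so that $B_{\Omega_j}(R_{\Omega_j}TR_{\Omega_j}^*)$ is defined on $K$. Furthermore, suppose that $\Omega$ is bounded (in which case $K^{\Omega}(z,z)\ne 0$ for all $z\in\Omega$ and $K^{\Omega_j}(z,z)\neq 0$ for all $z\in\Omega_j$ and all $j$), and let $E$ denote extension of functions by zero. Then, for every $0<p<\infty$, the functions $E B_{\Omega_j}(R_{\Omega_j}TR_{\Omega_j}^*)$ and $B_\Omega T$ belong to $L^p(\Omega)$, and $$E B_{\Omega_j}\big(R_{\Omega_j}TR_{\Omega_j}^*\big)\to B_\Omega T\quad\text{in } L^p(\Omega)\text{ as } j\to\infty,$$ that is, $\int_\Omega \big|E B_{\Omega_j}(R_{\Omega_j}TR_{\Omega_j}^*)-B_\Omega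 T\big|^p\,dV\to 0$. -/

import Mathlib

open MeasureTheory Filter Topology Metric

namespace Bergman

theorem measurePreserving_rotation {n : ℕ} (c : ℂ) (hc : ‖c‖ = 1) :
    MeasurePreserving (fun w : Fin n → ℂ => c • w) volume volume := by
  have h1 : MeasurePreserving (fun w : ℂ => c * w) volume volume := by
    have := (rotation ⟨c, by simpa [Submonoid.unitSphere] using hc⟩).measurePreserving
    exact this
  exact volume_preserving_pi (fun _ : Fin n => h1)

theorem integral_ball_eq {n : ℕ} {f : (Fin n → ℂ) → ℂ} {z : Fin n → ℂ} {r : ℝ}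
    {U : Set (Fin n → ℂ)}
    (hf : DifferentiableOn ℂ f U) (hz : closedBall z r ⊆ U) :
    ∫ w in closedBall (0 : Fin n → ℂ) r, f (z + w) =
      (volume.real (closedBall (0 : Fin n → ℂ) r) : ℂ) * f z := by
  set B := closedBall (0 : Fin n → ℂ) r with hB
  have hBc : IsCompact B := isCompact_closedBall _ _
  have hmem : ∀ w ∈ B, ∀ c : ℂ, ‖c‖ ≤ 1 → z + c • w ∈ U := by
    intro w hw c hc
    apply hz
    simp only [hB, mem_closedBall, dist_zero_right] at hw
    rw [mem_closedBall, dist_eq_norm, add_sub_cancel_left, norm_smul]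
    nlinarith [norm_nonneg w, norm_nonneg c]
  -- mean value along each complex line
  have hmean : ∀ w ∈ B, (∫ θ in (0 : ℝ)..2 * Real.pi, f (z + circleMap 0 1 θ • w)) =
      (2 * Real.pi : ℝ) • f z := by
    intro w hw
    have hd : DiffContOnCl ℂ (fun c : ℂ => f (z + c • w)) (ball 0 |(1 : ℝ)|) := by
      apply DifferentiableOn.diffContOnCl
      rw [abs_one, closure_ball _ one_ne_zero]
      refine hf.comp (g := f) (f := fun c : ℂ => z + c • w) (by fun_prop) ?_
      intro c hc
      exact hmem w hw c (by simpa using hc)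
    have := hd.circleAverage
    simp only [Real.circleAverage, zero_smul, add_zero] at this
    rw [← this, smul_smul, mul_inv_cancel₀ (by positivity), one_smul]
  have hcont : ContinuousOn (fun p : ℝ × (Fin n → ℂ) => f (z + circleMap 0 1 p.1 • p.2))
      (Set.Icc 0 (2 * Real.pi) ×ˢ B) := by
    refine hf.continuousOn.comp (g := f)
      (f := fun p : ℝ × (Fin n → ℂ) => z + circleMap 0 1 p.1 • p.2)
      (by fun_prop) ?_
    intro p hp
    exact hmem _ hp.2 _ (by simp)
  have hint : Integrable (fun p : ℝ × (Fin n → ℂ) => f (z + circleMap 0 1 p.1 • p.2))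
      ((volume.restrict (Set.uIoc 0 (2 * Real.pi))).prod (volume.restrict B)) := by
    rw [Measure.prod_restrict]
    have h1 : IntegrableOn (fun p : ℝ × (Fin n → ℂ) => f (z + circleMap 0 1 p.1 • p.2))
      (Set.Icc 0 (2 * Real.pi) ×ˢ B) (volume.prod volume) :=
      hcont.integrableOn_compact (isCompact_Icc.prod hBc)
    refine h1.mono_set (Set.prod_mono ?_ le_rfl)
    rw [Set.uIoc_of_le (by positivity)]
    exact Set.Ioc_subset_Icc_self
  have hrot : ∀ θ : ℝ, (∫ w in B, f (z + circleMap 0 1 θ • w)) = ∫ w in B, f (z + w) := by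
    intro θ
    have hc : ‖circleMap 0 1 θ‖ = 1 := by simp
    have hmp := measurePreserving_rotation (n := n) (circleMap 0 1 θ) hc
    have hne : circleMap 0 1 θ ≠ 0 := by
      intro h; simp [h] at hc
    have := hmp.setIntegral_preimage_emb
      (measurableEmbedding_const_smul₀ (α := Fin n → ℂ) hne) (fun w => f (z + w)) B
    rw [← this]
    congr 2
    ext w
    simp [hB, norm_smul]
  have hswap := intervalIntegral_integral_swap (μ := volume.restrict B)
    (f := fun θ w => f (z + circleMap 0 1 θ • w)) (a := 0) (b := 2 * Real.pi) hint
  simp only [hrot] at hswap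
  rw [setIntegral_congr_fun isClosed_closedBall.measurableSet hmean] at hswap
  simp only [intervalIntegral.integral_const, integral_const, sub_zero,
    measureReal_restrict_apply_univ] at hswap
  rw [smul_comm] at hswap
  have h2 := smul_right_injective ℂ (r := 2 * Real.pi) (by positivity) hswap
  rw [h2, Complex.real_smul]

/-- Sub-mean-value bound. -/
theorem sq_norm_le_integral {n : ℕ} {f : (Fin n → ℂ) → ℂ} {z : Fin n → ℂ} {r : ℝ}
    {U : Set (Fin n → ℂ)}
    (hf : DifferentiableOn ℂ f U) (hz : closedBall z r ⊆ U) :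
    volume.real (closedBall (0 : Fin n → ℂ) r) * ‖f z‖ ^ 2 ≤
      ∫ w in closedBall z r, ‖f w‖ ^ 2 := by
  have h := integral_ball_eq (hf.pow 2) hz
  have h1 : ‖∫ w in closedBall (0 : Fin n → ℂ) r, (f ^ 2) (z + w)‖ =
      volume.real (closedBall (0 : Fin n → ℂ) r) * ‖f z‖ ^ 2 := by
    rw [h]; simp
  rw [← h1]
  refine (norm_integral_le_integral_norm _).trans (le_of_eq ?_)
  have := (measurePreserving_add_left (volume : Measure (Fin n → ℂ)) z).setIntegral_preimage_emb
    (measurableEmbedding_addLeft z) (fun w => ‖f w‖ ^ 2) (closedBall z r)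
  rw [← this]
  congr 2
  · ext w
    simp [dist_eq_norm]
  · ext w; simp

theorem norm_fderiv_le {n : ℕ} {f : (Fin n → ℂ) → ℂ} {z : Fin n → ℂ} {r C : ℝ} (hr : 0 < r)
    {U : Set (Fin n → ℂ)} (hU : IsOpen U)
    (hf : DifferentiableOn ℂ f U) (hz : closedBall z r ⊆ U)
    (hC : ∀ w ∈ closedBall z r, ‖f w‖ ≤ C) : ‖fderiv ℂ f z‖ ≤ C / r := by
  have hzz : z ∈ closedBall z r := mem_closedBall_self hr.le
  have hC0 : 0 ≤ C := (norm_nonneg _).trans (hC z hzz)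
  refine ContinuousLinearMap.opNorm_le_of_unit_norm (by positivity) ?_
  intro v hv
  have hd : DifferentiableOn ℂ (fun c : ℂ => f (z + c • v)) (closedBall 0 r) := by
    refine hf.comp (g := f) (f := fun c : ℂ => z + c • v) (by fun_prop) ?_
    intro c hc
    apply hz
    simpa [dist_eq_norm, norm_smul, hv] using hc
  have hder : HasDerivAt (fun c : ℂ => f (z + c • v)) (fderiv ℂ f z v) 0 := by
    have h1 : HasFDerivAt f (fderiv ℂ f z) (z + (0 : ℂ) • v) := by
      rw [zero_smul, add_zero]
      exact (hf.differentiableAt (hU.mem_nhds (hz hzz))).hasFDerivAt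
    have h2 : HasDerivAt (fun c : ℂ => z + c • v) v 0 := by
      simpa using ((hasDerivAt_id (0 : ℂ)).smul_const v).const_add z
    exact h1.comp_hasDerivAt 0 h2
  rw [← hder.deriv]
  refine Complex.norm_deriv_le_of_forall_mem_sphere_norm_le hr ?_ ?_
  · apply DifferentiableOn.diffContOnCl
    rwa [closure_ball _ hr.ne']
  · intro c hc
    apply hC
    simpa [dist_eq_norm, norm_smul, hv] using (mem_sphere_iff_norm.1 hc).le

/-- The Bergman space `A²(Ω)`: the classes in `L²(Ω)` (with respect to Lebesgue measure) that
have a representative which is holomorphic on `Ω`. -/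
def bergmanSpace {n : ℕ} (Ω : TopologicalSpace.Opens (Fin n → ℂ)) :
    Submodule ℂ (Lp ℂ 2 (volume.restrict (Ω : Set (Fin n → ℂ)))) where
  carrier := {f | ∃ g : (Fin n → ℂ) → ℂ, DifferentiableOn ℂ g Ω ∧
    f =ᵐ[volume.restrict (Ω : Set (Fin n → ℂ))] g}
  add_mem' := by
    rintro f₁ f₂ ⟨g₁, h₁, e₁⟩ ⟨g₂, h₂, e₂⟩
    exact ⟨g₁ + g₂, h₁.add h₂, (Lp.coeFn_add f₁ f₂).trans (e₁.add e₂)⟩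
  zero_mem' := ⟨0, differentiableOn_const 0, Lp.coeFn_zero _ _ _⟩
  smul_mem' := by
    rintro c f ⟨g, h, e⟩
    exact ⟨c • g, h.const_smul c, (Lp.coeFn_smul c f).trans (e.const_smul c)⟩

variable {n : ℕ} {Ω : TopologicalSpace.Opens (Fin n → ℂ)}

/-- The holomorphic representative of an element of `A²(Ω)`; only its values on `Ω`, which are
uniquely determined, are meaningful. -/
noncomputable def rep (f : bergmanSpace Ω) : (Fin n → ℂ) → ℂ := f.2.choose

theorem rep_differentiableOn (f : bergmanSpace Ω) : DifferentiableOn ℂ (rep f) Ω :=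
  f.2.choose_spec.1

theorem rep_ae (f : bergmanSpace Ω) :
    (f : Lp ℂ 2 (volume.restrict (Ω : Set (Fin n → ℂ)))) =ᵐ[volume.restrict
      (Ω : Set (Fin n → ℂ))] rep f :=
  f.2.choose_spec.2

theorem rep_unique (f : bergmanSpace Ω) {g : (Fin n → ℂ) → ℂ} (hg : ContinuousOn g Ω)
    (h : (f : Lp ℂ 2 (volume.restrict (Ω : Set (Fin n → ℂ)))) =ᵐ[volume.restrict
      (Ω : Set (Fin n → ℂ))] g) : Set.EqOn (rep f) g Ω :=
  Measure.eqOn_open_of_ae_eq ((rep_ae f).symm.trans h) Ω.isOpen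
    (rep_differentiableOn f).continuousOn hg

theorem rep_add (f g : bergmanSpace Ω) : Set.EqOn (rep (f + g)) (rep f + rep g) Ω :=
  rep_unique _ ((rep_differentiableOn f).continuousOn.add (rep_differentiableOn g).continuousOn)
    ((Lp.coeFn_add _ _).trans ((rep_ae f).add (rep_ae g)))

theorem rep_smul (c : ℂ) (f : bergmanSpace Ω) : Set.EqOn (rep (c • f)) (c • rep f) Ω :=
  rep_unique _ ((rep_differentiableOn f).continuousOn.const_smul c)
    ((Lp.coeFn_smul _ _).trans ((rep_ae f).const_smul c))

theorem rep_sub (f g : bergmanSpace Ω) : Set.EqOn (rep (f - g)) (rep f - rep g) Ω :=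
  rep_unique _ ((rep_differentiableOn f).continuousOn.sub (rep_differentiableOn g).continuousOn)
    ((Lp.coeFn_sub _ _).trans ((rep_ae f).sub (rep_ae g)))

theorem norm_rep_le (f : bergmanSpace Ω) {z : Fin n → ℂ} {r : ℝ} (hr : 0 < r)
    (hz : closedBall z r ⊆ Ω) :
    ‖rep f z‖ ≤ (√(volume.real (closedBall (0 : Fin n → ℂ) r)))⁻¹ * ‖f‖ := by
  have hV : 0 < volume.real (closedBall (0 : Fin n → ℂ) r) :=
    ENNReal.toReal_pos (measure_closedBall_pos _ _ hr).ne' measure_closedBall_lt_top.ne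
  have hL2 : MemLp (rep f) 2 (volume.restrict (Ω : Set (Fin n → ℂ))) :=
    (memLp_congr_ae (rep_ae f)).1 (Lp.memLp _)
  have h1 := sq_norm_le_integral (rep_differentiableOn f) hz
  have h2 : ∫ w in closedBall z r, ‖rep f w‖ ^ 2 ≤ ∫ w in (Ω : Set (Fin n → ℂ)), ‖rep f w‖ ^ 2 :=
    setIntegral_mono_set ((memLp_two_iff_integrable_sq_norm hL2.1).1 hL2) (ae_of_all _ fun _ => by positivity)
      hz.eventuallyLE
  have h3 : ∫ w in (Ω : Set (Fin n → ℂ)), ‖rep f w‖ ^ 2 = ‖f‖ ^ 2 := by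
    have e1 := L2.inner_def (𝕜 := ℂ) (f : Lp ℂ 2 (volume.restrict (Ω : Set (Fin n → ℂ)))) f
    simp only [inner_self_eq_norm_sq_to_K] at e1
    have e2 : ∫ w in (Ω : Set (Fin n → ℂ)), ((‖rep f w‖ : ℂ)) ^ 2 = (‖f‖ : ℂ) ^ 2 := by
      refine Eq.trans (integral_congr_ae ?_) e1.symm
      filter_upwards [rep_ae f] with w hw
      simp [hw]
    have e3 : ((∫ w in (Ω : Set (Fin n → ℂ)), ‖rep f w‖ ^ 2 : ℝ) : ℂ) = ((‖f‖ ^ 2 : ℝ) : ℂ) := by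
      rw [← integral_complex_ofReal]
      push_cast
      exact e2
    exact_mod_cast e3
  have h4 : √(volume.real (closedBall (0 : Fin n → ℂ) r)) * ‖rep f z‖ ≤ ‖f‖ := by
    apply abs_le_of_sq_le_sq' _ (norm_nonneg f) |>.2
    rw [mul_pow, Real.sq_sqrt hV.le]
    linarith
  rw [inv_mul_eq_div, le_div_iff₀ (by positivity)]
  linarith

theorem bergmanSpace_isClosed :
    IsClosed (bergmanSpace Ω : Set (Lp ℂ 2 (volume.restrict (Ω : Set (Fin n → ℂ))))) := by
  refine IsSeqClosed.isClosed ?_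
  intro u f hu hlim
  let v : ℕ → bergmanSpace Ω := fun m => ⟨u m, hu m⟩
  have hcau : CauchySeq v := by
    have := hlim.cauchySeq
    rw [Metric.cauchySeq_iff] at this ⊢
    exact this
  -- uniform Cauchy estimates
  have hrep : ∀ z r, 0 < r → closedBall z r ⊆ (Ω : Set (Fin n → ℂ)) →
      ∀ k l, ‖rep (v k) z - rep (v l) z‖ ≤
        (√(volume.real (closedBall (0 : Fin n → ℂ) r)))⁻¹ * dist (v k) (v l) := by
    intro z r hr hz k l
    have h := rep_sub (v k) (v l) (hz (mem_closedBall_self hr.le))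
    rw [Pi.sub_apply] at h
    rw [← h, dist_eq_norm]
    exact norm_rep_le _ hr hz
  have hder : ∀ z r, 0 < r → closedBall z (2 * r) ⊆ (Ω : Set (Fin n → ℂ)) →
      ∀ k l, ‖fderiv ℂ (rep (v k)) z - fderiv ℂ (rep (v l)) z‖ ≤
      ((√(volume.real (closedBall (0 : Fin n → ℂ) r)))⁻¹ / r) * dist (v k) (v l) := by
    intro z r hr hz k l
    have hzΩ : z ∈ (Ω : Set (Fin n → ℂ)) := hz (mem_closedBall_self (by positivity))
    have hsub : fderiv ℂ (rep (v k)) z - fderiv ℂ (rep (v l)) z =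
        fderiv ℂ (rep (v k - v l)) z := by
      have hd := fun m => (rep_differentiableOn (v m)).differentiableAt (Ω.isOpen.mem_nhds hzΩ)
      rw [← fderiv_sub (hd k) (hd l)]
      exact ((rep_sub (v k) (v l)).eventuallyEq_of_mem (Ω.isOpen.mem_nhds hzΩ)).symm.fderiv_eq
    rw [hsub, dist_eq_norm]
    refine (norm_fderiv_le hr Ω.isOpen (rep_differentiableOn (v k - v l))
      ((closedBall_subset_closedBall (by linarith)).trans hz) (fun w hw => norm_rep_le _ hr
        ((closedBall_subset_closedBall' (by rw [mem_closedBall] at hw; linarith)).trans hz))).trans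
      (le_of_eq (by ring))
  have hsmall : ∀ C : ℝ, ∀ ε > 0, ∃ N, ∀ k ≥ N, ∀ l ≥ N, C * dist (v k) (v l) < ε := by
    intro C ε hε
    obtain ⟨N, hN⟩ := Metric.cauchySeq_iff.1 hcau (ε / (|C| + 1)) (by positivity)
    refine ⟨N, fun k hk l hl => ?_⟩
    have h1 := hN k hk l hl
    rw [lt_div_iff₀ (by positivity)] at h1
    nlinarith [le_abs_self C, dist_nonneg (x := v k) (y := v l)]
  have hball : ∀ x ∈ (Ω : Set (Fin n → ℂ)), ∃ r > 0, ∀ y ∈ ball x r,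
      closedBall y (2 * r) ⊆ (Ω : Set (Fin n → ℂ)) := by
    intro x hx
    obtain ⟨R, hR, hRs⟩ := Metric.nhds_basis_closedBall.mem_iff.1 (Ω.isOpen.mem_nhds hx)
    refine ⟨R / 3, by positivity, fun y hy => ?_⟩
    refine (closedBall_subset_closedBall' ?_).trans hRs
    rw [mem_ball] at hy
    linarith
  have hlim1 : ∀ x ∈ (Ω : Set (Fin n → ℂ)), ∃ a, Tendsto (fun k => rep (v k) x) atTop (𝓝 a) := by
    intro x hx
    obtain ⟨r, hr, hrs⟩ := hball x hx
    refine cauchySeq_tendsto_of_complete (Metric.cauchySeq_iff.2 fun ε hε => ?_)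
    obtain ⟨N, hN⟩ := hsmall _ ε hε
    refine ⟨N, fun k hk l hl => lt_of_le_of_lt ?_ (hN k hk l hl)⟩
    rw [dist_eq_norm]
    exact hrep x (2 * r) (by positivity) (hrs x (mem_ball_self hr)) k l
  have hcau' : ∀ x ∈ (Ω : Set (Fin n → ℂ)), ∃ r > 0, ball x r ⊆ (Ω : Set (Fin n → ℂ)) ∧
      UniformCauchySeqOn (fun k => fderiv ℂ (rep (v k))) atTop (ball x r) := by
    intro x hx
    obtain ⟨r, hr, hrs⟩ := hball x hx
    refine ⟨r, hr, fun y hy => hrs y hy (mem_closedBall_self (by positivity)), ?_⟩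
    refine Metric.uniformCauchySeqOn_iff.2 fun ε hε => ?_
    obtain ⟨N, hN⟩ := hsmall _ ε hε
    refine ⟨N, fun k hk l hl y hy => lt_of_le_of_lt ?_ (hN k hk l hl)⟩
    rw [dist_eq_norm]
    exact hder y r hr (hrs y hy) k l
  have hlim2 : ∀ x ∈ (Ω : Set (Fin n → ℂ)),
      ∃ a, Tendsto (fun k => fderiv ℂ (rep (v k)) x) atTop (𝓝 a) := by
    intro x hx
    obtain ⟨r, hr, -, h⟩ := hcau' x hx
    exact cauchySeq_tendsto_of_complete (h.cauchySeq (mem_ball_self hr))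
  choose! g hg using hlim1
  choose! g' hg' using hlim2
  refine ⟨g, fun x hx => ?_, ?_⟩
  · obtain ⟨r, hr, hs, h⟩ := hcau' x hx
    exact (hasFDerivAt_of_tendstoUniformlyOn isOpen_ball
      (h.tendstoUniformlyOn_of_tendsto fun y hy => hg' y (hs hy))
      (fun k y hy => ((rep_differentiableOn (v k)).differentiableAt
        (Ω.isOpen.mem_nhds (hs hy))).hasFDerivAt)
      (fun y hy => hg y (hs hy)) (mem_ball_self hr)).differentiableAt.differentiableWithinAt
  · obtain ⟨ns, hns, hae⟩ := (tendstoInMeasure_of_tendsto_Lp hlim).exists_seq_tendsto_ae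
    have hall : ∀ᵐ x ∂(volume.restrict (Ω : Set (Fin n → ℂ))), ∀ k, u k x = rep (v k) x :=
      ae_all_iff.2 fun k => rep_ae (v k)
    filter_upwards [hae, hall, ae_restrict_mem Ω.isOpen.measurableSet] with x h1 h2 h3
    simp only [h2] at h1
    exact tendsto_nhds_unique h1 ((hg x h3).comp hns.tendsto_atTop)

instance : CompleteSpace (bergmanSpace Ω) :=
  bergmanSpace_isClosed.completeSpace_coe

/-- The inner product of `A²(Ω)`, inherited from `L²(Ω)`; this fixes the instance that the notation
`inner ℂ f g` finds. -/
noncomputable instance : Inner ℂ (bergmanSpace Ω) :=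
  (Submodule.innerProductSpace (𝕜 := ℂ) (bergmanSpace Ω)).toInner

/-- Point evaluation `f ↦ f(z)` on `A²(Ω)`, a bounded linear functional. -/
noncomputable def pointEval (z : Ω) : bergmanSpace Ω →L[ℂ] ℂ :=
  LinearMap.mkContinuousOfExistsBound
    { toFun := fun f => rep f z
      map_add' := fun f g => rep_add f g z.2
      map_smul' := fun c f => rep_smul c f z.2 } (by
    obtain ⟨R, hR, hRs⟩ := Metric.nhds_basis_closedBall.mem_iff.1 (Ω.isOpen.mem_nhds z.2)
    exact ⟨_, fun f => norm_rep_le f hR hRs⟩)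

/-- The function `K_z = K(·, z)` in `A²(Ω)`, characterized by `⟨f, K_z⟩ = f(z)` for all `f` in
`A²(Ω)` (Riesz representation of point evaluation). -/
noncomputable def kernelFun (z : Ω) : bergmanSpace Ω :=
  (InnerProductSpace.toDual ℂ (bergmanSpace Ω)).symm (pointEval z)

/-- The reproducing property. In Mathlib the inner product is conjugate-linear in its first
argument, so `inner ℂ a b` is the mathematician's `⟨b, a⟩`. -/
theorem inner_kernelFun (z : Ω) (f : bergmanSpace Ω) : inner ℂ (kernelFun z) f = pointEval z f :=
  InnerProductSpace.toDual_symm_apply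

/-- The Bergman kernel `K^Ω(w, z)`. -/
noncomputable def bergmanKernel (Ω : TopologicalSpace.Opens (Fin n → ℂ)) (w z : Ω) : ℂ :=
  pointEval w (kernelFun z)

/-- The set `𝒵` of those `z` in `Ω` with `K^Ω(z, z) = 0`. -/
def kernelZeroSet (Ω : TopologicalSpace.Opens (Fin n → ℂ)) : Set (Fin n → ℂ) :=
  {z | ∃ hz : z ∈ Ω, bergmanKernel Ω ⟨z, hz⟩ ⟨z, hz⟩ = 0}

/-- The normalized Bergman kernel `k_z = K(·, z) / √K(z, z)`; here `K(z, z)` is a nonnegative real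
number, and `k_z` is meaningful if it is nonzero. -/
noncomputable def normalizedKernel (z : Ω) : bergmanSpace Ω :=
  ((√(bergmanKernel Ω z z).re : ℝ) : ℂ)⁻¹ • kernelFun z

/-- The Berezin transform `B_Ω T(z) = ⟨T k_z, k_z⟩` (linear in `T k_z`). -/
noncomputable def berezin (T : bergmanSpace Ω →L[ℂ] bergmanSpace Ω) (z : Ω) : ℂ :=
  inner ℂ (normalizedKernel z) (T (normalizedKernel z))

/-- The extension by zero of a function on `Ω` to all of `ℂⁿ`. -/
noncomputable def zeroExt (f : Ω → ℂ) : (Fin n → ℂ) → ℂ :=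
  Function.extend Subtype.val f 0

/-- The restriction operator `R_U : A²(Ω) → A²(U)`, `f ↦ f|_U`, for open `U ⊆ Ω`. -/
noncomputable def restriction {U : TopologicalSpace.Opens (Fin n → ℂ)} (h : U ≤ Ω) :
    bergmanSpace Ω →L[ℂ] bergmanSpace U :=
  have hle : volume.restrict (U : Set (Fin n → ℂ)) ≤ volume.restrict (Ω : Set (Fin n → ℂ)) :=
    Measure.restrict_mono_set _ h
  have hmem : ∀ f : bergmanSpace Ω, MemLp (f : Lp ℂ 2 (volume.restrict (Ω : Set (Fin n → ℂ)))) 2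
      (volume.restrict (U : Set (Fin n → ℂ))) := fun f => (Lp.memLp _).mono_measure hle
  LinearMap.mkContinuous
    { toFun := fun f => ⟨(hmem f).toLp _, rep f, (rep_differentiableOn f).mono h,
        (hmem f).coeFn_toLp.trans ((rep_ae f).filter_mono (ae_mono hle))⟩
      map_add' := fun f g => by
        refine Subtype.ext (Lp.ext ?_)
        refine (hmem (f + g)).coeFn_toLp.trans (Filter.EventuallyEq.trans ?_
          (Lp.coeFn_add _ _).symm)
        refine ((Lp.coeFn_add _ _).filter_mono (ae_mono hle)).trans ?_
        exact ((hmem f).coeFn_toLp.add (hmem g).coeFn_toLp).symm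
      map_smul' := fun c f => by
        refine Subtype.ext (Lp.ext ?_)
        refine (hmem (c • f)).coeFn_toLp.trans (Filter.EventuallyEq.trans ?_
          (Lp.coeFn_smul _ _).symm)
        refine ((Lp.coeFn_smul _ _).filter_mono (ae_mono hle)).trans ?_
        exact ((hmem f).coeFn_toLp.const_smul c).symm } 1 (by
    intro f
    rw [one_mul]
    change ‖(hmem f).toLp _‖ ≤ ‖(f : Lp ℂ 2 (volume.restrict (Ω : Set (Fin n → ℂ))))‖
    rw [Lp.norm_toLp, Lp.norm_def]
    exact ENNReal.toReal_mono (Lp.eLpNorm_ne_top _) (eLpNorm_mono_measure _ hle))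

/-- The operator `R_U T R_U^*` on `A²(U)`, where `T` is a bounded operator on `A²(Ω)`. -/
noncomputable def compression {U : TopologicalSpace.Opens (Fin n → ℂ)} (h : U ≤ Ω)
    (T : bergmanSpace Ω →L[ℂ] bergmanSpace Ω) : bergmanSpace U →L[ℂ] bergmanSpace U :=
  restriction h ∘L T ∘L ContinuousLinearMap.adjoint (restriction h)

/-- A non-trivial Bergman domain: a domain (connected, nonempty, open) with `A²(Ω) ≠ {0}`. -/
def IsNontrivialBergmanDomain (Ω : TopologicalSpace.Opens (Fin n → ℂ)) : Prop :=
  IsConnected (Ω : Set (Fin n → ℂ)) ∧ Nontrivial (bergmanSpace Ω)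

end Bergman

namespace Bergman

variable {n : ℕ} {Ω : TopologicalSpace.Opens (Fin n → ℂ)}

/-! The operator `T` enters only through `B_Ω T`. For `U ⊆ Ω`, the adjoint of restriction sends
`K^U_z` to `K^Ω_z`, because pairing either side with `f` gives `f(z)`
(`adjoint_restriction_kernelFun`). Hence `B_U(R T R^*)(z) = (K^Ω(z,z) / K^U(z,z)) * B_Ω T(z)`
(`berezin_compression_eq_div`). Since restriction is a contraction, the quotient lies in `[0, 1]`;
since `|B_Ω T| ≤ ‖T‖`, everything reduces to showing that `K^{Ω_j}(z,z) / K^Ω(z,z)` tends to `1`.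

This is Ramadanov's theorem (`tendsto_norm_kernelFun_sq`). Extend `K^{Ω_j}_z` by zero to `v_j` in
`L²(Ω)`. For `j ≤ k` the reproducing property gives `‖v_j - v_k‖² = K^{Ω_j}(z,z) - K^{Ω_k}(z,z)`.
The diagonal values decrease in `j` and are nonnegative, so `v_j` is Cauchy. Its limit is
holomorphic on every `Ω_j`, hence on `Ω`, and reproduces values at `z`, so it is `K^Ω_z`.

On a compact set avoiding the zeros of `K^Ω(z,z)`, the quotients are continuous and increase to `1`,
so Dini's theorem makes the convergence uniform. For bounded `Ω`, pointwise convergence together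
with the common bound `‖T‖` gives convergence in `L^p` by dominated convergence. -/

/-! ### Restriction, its adjoint, and the Berezin transform of a compression -/

theorem restriction_ae {U : TopologicalSpace.Opens (Fin n → ℂ)} (h : U ≤ Ω)
    (f : bergmanSpace Ω) :
    (restriction h f : Lp ℂ 2 (volume.restrict (U : Set (Fin n → ℂ)))) =ᵐ[volume.restrict
      (U : Set (Fin n → ℂ))] (f : Lp ℂ 2 (volume.restrict (Ω : Set (Fin n → ℂ)))) :=
  MemLp.coeFn_toLp ((Lp.memLp _).mono_measure (Measure.restrict_mono_set _ h))

theorem rep_restriction {U : TopologicalSpace.Opens (Fin n → ℂ)} (h : U ≤ Ω)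
    (f : bergmanSpace Ω) : Set.EqOn (rep (restriction h f)) (rep f) U :=
  rep_unique _ ((rep_differentiableOn f).continuousOn.mono h)
    ((restriction_ae h f).trans
      ((rep_ae f).filter_mono (ae_mono (Measure.restrict_mono_set _ h))))

theorem pointEval_restriction {U : TopologicalSpace.Opens (Fin n → ℂ)} (h : U ≤ Ω) (z : U)
    (f : bergmanSpace Ω) : pointEval z (restriction h f) = pointEval ⟨z, h z.2⟩ f :=
  rep_restriction h f z.2

theorem norm_restriction_le {U : TopologicalSpace.Opens (Fin n → ℂ)} (h : U ≤ Ω) :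
    ‖restriction h‖ ≤ 1 :=
  by unfold restriction; exact LinearMap.mkContinuous_norm_le _ zero_le_one _

theorem adjoint_restriction_kernelFun {U : TopologicalSpace.Opens (Fin n → ℂ)} (h : U ≤ Ω)
    (z : U) :
    ContinuousLinearMap.adjoint (restriction h) (kernelFun z) = kernelFun ⟨z, h z.2⟩ := by
  refine ext_inner_right ℂ fun f => ?_
  rw [ContinuousLinearMap.adjoint_inner_left]
  exact (inner_kernelFun z _).trans
    ((pointEval_restriction h z f).trans (inner_kernelFun _ f).symm)

/-- The larger kernel function is the image of the smaller one under the adjoint of a contraction.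
-/
theorem norm_kernelFun_le {U : TopologicalSpace.Opens (Fin n → ℂ)} (h : U ≤ Ω) (z : U) :
    ‖kernelFun (⟨z, h z.2⟩ : Ω)‖ ≤ ‖kernelFun z‖ := by
  rw [← adjoint_restriction_kernelFun h z]
  refine (ContinuousLinearMap.le_opNorm _ _).trans ?_
  rw [LinearIsometryEquiv.norm_map]
  exact mul_le_of_le_one_left (norm_nonneg _) (norm_restriction_le h)

theorem bergmanKernel_self (z : Ω) : bergmanKernel Ω z z = ((‖kernelFun z‖ ^ 2 : ℝ) : ℂ) := by
  rw [bergmanKernel, ← inner_kernelFun]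
  push_cast
  exact inner_self_eq_norm_sq_to_K _

theorem normalizedKernel_eq (z : Ω) :
    normalizedKernel z = ((‖kernelFun z‖ : ℝ) : ℂ)⁻¹ • kernelFun z := by
  rw [normalizedKernel, bergmanKernel_self, Complex.ofReal_re, Real.sqrt_sq (norm_nonneg _)]

theorem berezin_eq (T : bergmanSpace Ω →L[ℂ] bergmanSpace Ω) (z : Ω) :
    berezin T z =
      ((‖kernelFun z‖ ^ 2 : ℝ) : ℂ)⁻¹ * inner ℂ (kernelFun z) (T (kernelFun z)) := by
  rw [berezin, normalizedKernel_eq, map_smul]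
  refine (inner_smul_left (𝕜 := ℂ) (kernelFun z) _ _).trans ?_
  rw [map_inv₀, Complex.conj_ofReal]
  refine (congrArg _ (inner_smul_right (𝕜 := ℂ) (kernelFun z) _ _)).trans ?_
  rw [← mul_assoc]
  push_cast
  rw [sq, mul_inv]

theorem norm_berezin_le (T : bergmanSpace Ω →L[ℂ] bergmanSpace Ω) (z : Ω) :
    ‖berezin T z‖ ≤ ‖T‖ := by
  have h1 : ‖normalizedKernel z‖ ≤ 1 := by
    rw [normalizedKernel_eq, norm_smul, norm_inv, Complex.norm_real, norm_norm]
    exact inv_mul_le_one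
  refine (norm_inner_le_norm (𝕜 := ℂ) (normalizedKernel z) _).trans ?_
  have h2 := T.le_opNorm (normalizedKernel z)
  have h3 := mul_le_of_le_one_right (norm_nonneg T) h1
  exact (mul_le_of_le_one_left (norm_nonneg _) h1).trans (h2.trans h3)

theorem berezin_compression {U : TopologicalSpace.Opens (Fin n → ℂ)} (h : U ≤ Ω)
    (T : bergmanSpace Ω →L[ℂ] bergmanSpace Ω) (z : U) :
    berezin (compression h T) z = ((‖kernelFun z‖ ^ 2 : ℝ) : ℂ)⁻¹ *
      inner ℂ (kernelFun (⟨z, h z.2⟩ : Ω)) (T (kernelFun (⟨z, h z.2⟩ : Ω))) := by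
  rw [berezin_eq]
  congr 1
  rw [← adjoint_restriction_kernelFun h z]
  exact (ContinuousLinearMap.adjoint_inner_left (restriction h) _ _).symm

theorem berezin_compression_eq_div {U : TopologicalSpace.Opens (Fin n → ℂ)} (h : U ≤ Ω)
    (T : bergmanSpace Ω →L[ℂ] bergmanSpace Ω) (z : U) :
    berezin (compression h T) z =
      ((‖kernelFun (⟨z, h z.2⟩ : Ω)‖ ^ 2 / ‖kernelFun z‖ ^ 2 : ℝ) : ℂ) *
        berezin T ⟨z, h z.2⟩ := by
  rw [berezin_compression, berezin_eq]
  -- If `K^Ω_z = 0`, both sides vanish; otherwise `‖K^Ω_z‖²` cancels.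
  by_cases h0 : kernelFun (⟨z, h z.2⟩ : Ω) = 0
  · simp [h0]
  · have : ((‖kernelFun (⟨z, h z.2⟩ : Ω)‖ : ℝ) : ℂ) ≠ 0 := by simpa using h0
    push_cast
    field_simp

/-- The bound does not depend on `U`, so it can serve as the dominating constant for the whole
sequence. -/
theorem norm_berezin_compression_le {U : TopologicalSpace.Opens (Fin n → ℂ)} (h : U ≤ Ω)
    (T : bergmanSpace Ω →L[ℂ] bergmanSpace Ω) (z : U) :
    ‖berezin (compression h T) z‖ ≤ ‖T‖ := by
  rw [berezin_compression_eq_div, norm_mul, Complex.norm_real, Real.norm_of_nonneg (by positivity)]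
  refine (mul_le_of_le_one_left (norm_nonneg _) ?_).trans (norm_berezin_le T _)
  refine div_le_one_of_le₀ ?_ (by positivity)
  gcongr
  exact norm_kernelFun_le h z

/-! ### Continuity of the kernel function in its parameter -/

/-- Cauchy's estimate bounds the derivative near `z` by a multiple of `‖f‖`, and the mean value
inequality integrates it. The constant and the neighbourhood are uniform in `f`, so `f` may later
depend on `w`. -/
theorem exists_norm_rep_sub_le {z : Fin n → ℂ} (hz : z ∈ Ω) :
    ∃ C : ℝ, 0 ≤ C ∧ ∀ᶠ w in 𝓝 z, ∀ f : bergmanSpace Ω, ‖rep f w - rep f z‖ ≤ C * ‖f‖ * ‖w - z‖ := by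
  obtain ⟨R, hR, hRs⟩ := Metric.nhds_basis_closedBall.mem_iff.1 (Ω.isOpen.mem_nhds hz)
  -- Three radii fit into `R`: one for moving `y` away from `z`, one for the Cauchy estimate at `y`,
  -- one for the sub-mean-value bound around each point of that ball.
  set r := R / 3 with hr
  have hr0 : 0 < r := by positivity
  have hball : ∀ y ∈ ball z r, closedBall y (2 * r) ⊆ (Ω : Set (Fin n → ℂ)) := by
    intro y hy
    refine (closedBall_subset_closedBall' ?_).trans hRs
    rw [mem_ball] at hy
    linarith
  refine ⟨(√(volume.real (closedBall (0 : Fin n → ℂ) r)))⁻¹ / r, by positivity, ?_⟩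
  filter_upwards [ball_mem_nhds z hr0] with w hw f
  have hder : ∀ y ∈ ball z r, ‖fderiv ℂ (rep f) y‖ ≤
      (√(volume.real (closedBall (0 : Fin n → ℂ) r)))⁻¹ / r * ‖f‖ := by
    intro y hy
    refine (norm_fderiv_le hr0 Ω.isOpen (rep_differentiableOn f)
      ((closedBall_subset_closedBall (by linarith)).trans (hball y hy)) (fun w hw =>
        norm_rep_le f hr0 ((closedBall_subset_closedBall'
          (by rw [mem_closedBall] at hw; linarith)).trans (hball y hy)))).trans
      (le_of_eq (by ring))
  exact (convex_ball z r).norm_image_sub_le_of_norm_fderiv_le (𝕜 := ℂ)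
    (fun y hy => (rep_differentiableOn f).differentiableAt
      (Ω.isOpen.mem_nhds (hball y hy (mem_closedBall_self (by positivity)))))
    hder (mem_ball_self hr0) hw

/-- With `d = K_w - K_z`, the reproducing property gives `‖d‖² = |d(w) - d(z)| ≤ C ‖d‖ ‖w - z‖`;
dividing by `‖d‖` leaves a Lipschitz estimate at `z`. -/
theorem continuous_kernelFun : Continuous (kernelFun : Ω → bergmanSpace Ω) := by
  refine continuous_iff_continuousAt.2 fun z => ?_
  obtain ⟨C, hC0, hC⟩ := exists_norm_rep_sub_le z.2
  have hC' : ∀ᶠ w : Ω in 𝓝 z, ‖kernelFun w - kernelFun z‖ ≤ C * ‖(w : Fin n → ℂ) - z‖ := by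
    filter_upwards [continuous_subtype_val.continuousAt.eventually hC] with w hw
    set d := kernelFun w - kernelFun z with hd
    have h1 : inner ℂ d d = rep d w - rep d z := by
      refine (inner_sub_left (𝕜 := ℂ) (kernelFun w) (kernelFun z) d).trans ?_
      exact congrArg₂ _ (inner_kernelFun w d) (inner_kernelFun z d)
    have h2 : ‖d‖ ^ 2 = ‖rep d w - rep d z‖ := by
      rw [← h1]
      refine Eq.trans ?_ (congrArg norm (inner_self_eq_norm_sq_to_K (𝕜 := ℂ) d)).symm
      simp
    have h3 := hw d
    rw [← h2] at h3
    rcases (norm_nonneg d).eq_or_lt with h0 | h0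
    · rw [← h0]
      positivity
    · nlinarith
  rw [ContinuousAt, tendsto_iff_norm_sub_tendsto_zero]
  refine squeeze_zero' (Eventually.of_forall fun _ => norm_nonneg _) hC' ?_
  have h4 : Tendsto (fun w : Ω => C * ‖(w : Fin n → ℂ) - z‖) (𝓝 z)
      (𝓝 (C * ‖(z : Fin n → ℂ) - z‖)) :=
    Continuous.tendsto (by fun_prop) z
  simpa using h4

/-! ### Extension by zero into `L²(Ω)` -/

theorem memLp_rep (f : bergmanSpace Ω) :
    MemLp (rep f) 2 (volume.restrict (Ω : Set (Fin n → ℂ))) :=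
  (memLp_congr_ae (rep_ae f)).1 (Lp.memLp _)

theorem inner_eq_integral_rep (f g : bergmanSpace Ω) :
    inner ℂ f g = ∫ w in (Ω : Set (Fin n → ℂ)), inner ℂ (rep f w) (rep g w) := by
  refine (L2.inner_def (𝕜 := ℂ) (f : Lp ℂ 2 (volume.restrict (Ω : Set (Fin n → ℂ)))) g).trans ?_
  refine integral_congr_ae ?_
  filter_upwards [rep_ae f, rep_ae g] with w hf hg
  rw [hf, hg]

theorem memLp_indicator_rep {U : TopologicalSpace.Opens (Fin n → ℂ)} (h : U ≤ Ω)
    (f : bergmanSpace U) : MemLp (Set.indicator (U : Set (Fin n → ℂ)) (rep f)) 2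
      (volume.restrict (Ω : Set (Fin n → ℂ))) := by
  rw [memLp_indicator_iff_restrict U.isOpen.measurableSet,
    Measure.restrict_restrict_of_subset h]
  exact memLp_rep f

/-- Extension by zero of an element of `A²(U)` to an element of `L²(Ω)`, for `U ⊆ Ω`. -/
noncomputable def extendLp {U : TopologicalSpace.Opens (Fin n → ℂ)} (h : U ≤ Ω)
    (f : bergmanSpace U) : Lp ℂ 2 (volume.restrict (Ω : Set (Fin n → ℂ))) :=
  (memLp_indicator_rep h f).toLp _

theorem extendLp_ae {U : TopologicalSpace.Opens (Fin n → ℂ)} (h : U ≤ Ω) (f : bergmanSpace U) :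
    extendLp h f =ᵐ[volume.restrict (Ω : Set (Fin n → ℂ))]
      Set.indicator (U : Set (Fin n → ℂ)) (rep f) :=
  MemLp.coeFn_toLp _

theorem inner_extendLp {U : TopologicalSpace.Opens (Fin n → ℂ)} (h : U ≤ Ω) (f : bergmanSpace U)
    (g : Lp ℂ 2 (volume.restrict (Ω : Set (Fin n → ℂ)))) :
    inner ℂ (extendLp h f) g = ∫ w in (U : Set (Fin n → ℂ)), inner ℂ (rep f w) (g w) := by
  rw [L2.inner_def, ← Measure.restrict_restrict_of_subset h,
    ← integral_indicator U.isOpen.measurableSet]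
  refine integral_congr_ae ?_
  filter_upwards [extendLp_ae h f] with w hw
  rw [hw]
  by_cases hU : w ∈ (U : Set (Fin n → ℂ)) <;> simp [hU]

/-- Only the values of `u` on `U` matter. Allowing any such `u` covers both the zero extension of
`g` and, with `V = Ω`, the class of `g` itself. -/
theorem inner_extendLp_of_ae_eq {U V : TopologicalSpace.Opens (Fin n → ℂ)} (h : V ≤ Ω)
    (hUV : U ≤ V) (f : bergmanSpace U) (g : bergmanSpace V)
    (u : Lp ℂ 2 (volume.restrict (Ω : Set (Fin n → ℂ))))
    (hu : u =ᵐ[volume.restrict (U : Set (Fin n → ℂ))] rep g) :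
    inner ℂ (extendLp (hUV.trans h) f) u = inner ℂ f (restriction hUV g) := by
  rw [inner_extendLp, inner_eq_integral_rep]
  refine integral_congr_ae ?_
  filter_upwards [hu, ae_restrict_mem U.isOpen.measurableSet] with w h1 h2
  rw [h1, rep_restriction hUV g h2]

theorem extendLp_ae_restrict {U V : TopologicalSpace.Opens (Fin n → ℂ)} (h : V ≤ Ω)
    (hUV : U ≤ V) (g : bergmanSpace V) :
    extendLp h g =ᵐ[volume.restrict (U : Set (Fin n → ℂ))] rep g := by
  filter_upwards [(extendLp_ae h g).filter_mono
    (ae_mono (Measure.restrict_mono_set _ (hUV.trans h))),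
    ae_restrict_mem U.isOpen.measurableSet] with w h1 h2
  rw [h1, Set.indicator_of_mem (hUV h2)]

theorem inner_extendLp_extendLp {U V : TopologicalSpace.Opens (Fin n → ℂ)} (h : V ≤ Ω)
    (hUV : U ≤ V) (f : bergmanSpace U) (g : bergmanSpace V) :
    inner ℂ (extendLp (hUV.trans h) f) (extendLp h g) = inner ℂ f (restriction hUV g) :=
  inner_extendLp_of_ae_eq h hUV f g _ (extendLp_ae_restrict h hUV g)

theorem inner_extendLp_coe {U : TopologicalSpace.Opens (Fin n → ℂ)} (h : U ≤ Ω)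
    (f : bergmanSpace U) (g : bergmanSpace Ω) :
    inner ℂ (extendLp h f) (g : Lp ℂ 2 (volume.restrict (Ω : Set (Fin n → ℂ)))) =
      inner ℂ f (restriction h g) :=
  inner_extendLp_of_ae_eq le_rfl h f g _
    ((rep_ae g).filter_mono (ae_mono (Measure.restrict_mono_set _ h)))

theorem norm_extendLp {U : TopologicalSpace.Opens (Fin n → ℂ)} (h : U ≤ Ω) (f : bergmanSpace U) :
    ‖extendLp h f‖ = ‖f‖ := by
  have h1 : inner ℂ (extendLp h f) (extendLp h f) = inner ℂ f f := by
    rw [inner_extendLp_extendLp h le_rfl, inner_eq_integral_rep, inner_eq_integral_rep]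
    refine setIntegral_congr_fun U.isOpen.measurableSet fun w hw => ?_
    simp only [rep_restriction le_rfl f hw]
  have h2 := h1.trans (inner_self_eq_norm_sq_to_K (𝕜 := ℂ) f)
  rw [inner_self_eq_norm_sq_to_K] at h2
  exact (sq_eq_sq₀ (norm_nonneg _) (norm_nonneg _)).1 (by exact_mod_cast h2)

/-- Restriction of square integrable classes to a smaller measure. -/
noncomputable def lpMono {α : Type*} {m : MeasurableSpace α} {μ ν : Measure α} (h : μ ≤ ν) :
    Lp ℂ 2 ν →L[ℂ] Lp ℂ 2 μ :=
  have hmem : ∀ f : Lp ℂ 2 ν, MemLp f 2 μ := fun f => (Lp.memLp f).mono_measure h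
  LinearMap.mkContinuous
    { toFun := fun f => (hmem f).toLp _
      map_add' := fun f g => Lp.ext <| (hmem (f + g)).coeFn_toLp.trans <|
        ((Lp.coeFn_add f g).filter_mono (ae_mono h)).trans <|
        ((hmem f).coeFn_toLp.add (hmem g).coeFn_toLp).symm.trans (Lp.coeFn_add _ _).symm
      map_smul' := fun c f => Lp.ext <| (hmem (c • f)).coeFn_toLp.trans <|
        ((Lp.coeFn_smul c f).filter_mono (ae_mono h)).trans <|
        ((hmem f).coeFn_toLp.const_smul c).symm.trans (Lp.coeFn_smul _ _).symm } 1 (by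
    intro f
    rw [one_mul]
    change ‖(hmem f).toLp _‖ ≤ ‖f‖
    rw [Lp.norm_toLp, Lp.norm_def]
    exact ENNReal.toReal_mono (Lp.eLpNorm_ne_top _) (eLpNorm_mono_measure _ h))

theorem lpMono_ae {α : Type*} {m : MeasurableSpace α} {μ ν : Measure α} (h : μ ≤ ν)
    (f : Lp ℂ 2 ν) : lpMono h f =ᵐ[μ] f :=
  MemLp.coeFn_toLp ((Lp.memLp f).mono_measure h)

/-! ### Ramadanov's theorem -/

/-- Holomorphic representatives on the nested sets agree on overlaps, being continuous and almost
everywhere equal there, so they glue. The union is countable, so the exceptional null sets do no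
harm. -/
theorem mem_bergmanSpace_of_forall {Ωs : ℕ → TopologicalSpace.Opens (Fin n → ℂ)}
    (hmono : Monotone Ωs) (hΩ : ⨆ j, Ωs j = Ω)
    {u : Lp ℂ 2 (volume.restrict (Ω : Set (Fin n → ℂ)))}
    (hu : ∀ j, lpMono (Measure.restrict_mono_set _ ((le_iSup Ωs j).trans_eq hΩ)) u ∈
      bergmanSpace (Ωs j)) : u ∈ bergmanSpace Ω := by
  have hae : ∀ j, ∃ g : (Fin n → ℂ) → ℂ, DifferentiableOn ℂ g (Ωs j) ∧
      u =ᵐ[volume.restrict (Ωs j : Set (Fin n → ℂ))] g := by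
    intro j
    obtain ⟨g, hg, hge⟩ := hu j
    exact ⟨g, hg, (lpMono_ae _ u).symm.trans hge⟩
  choose g hg hge using hae
  have hcompat : ∀ j k, j ≤ k → Set.EqOn (g j) (g k) (Ωs j) := fun j k hjk =>
    Measure.eqOn_open_of_ae_eq ((hge j).symm.trans
      ((hge k).filter_mono (ae_mono (Measure.restrict_mono_set _ (hmono hjk)))))
      (Ωs j).isOpen (hg j).continuousOn ((hg k).continuousOn.mono (hmono hjk))
  have hcompat' : ∀ j k x, x ∈ Ωs j → x ∈ Ωs k → g j x = g k x := by
    intro j k x hj hk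
    rcases le_total j k with h | h
    · exact hcompat j k h hj
    · exact (hcompat k j h hk).symm
  have hcover : ∀ x ∈ Ω, ∃ j, x ∈ Ωs j := by
    intro x hx
    rwa [← hΩ, TopologicalSpace.Opens.mem_iSup] at hx
  choose! i hi using hcover
  have hG : ∀ j, Set.EqOn (fun x => g (i x) x) (g j) (Ωs j) := fun j x hx =>
    hcompat' _ _ _ (hi x (((le_iSup Ωs j).trans_eq hΩ) hx)) hx
  refine ⟨fun x => g (i x) x, fun x hx => ?_, ?_⟩
  · have hx' := hi x hx
    have hnhds := (Ωs (i x)).isOpen.mem_nhds hx'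
    exact (((hg (i x)).differentiableAt hnhds).congr_of_eventuallyEq
      ((hG (i x)).eventuallyEq_of_mem hnhds)).differentiableWithinAt
  · have hset : (Ω : Set (Fin n → ℂ)) = ⋃ j, (Ωs j : Set (Fin n → ℂ)) := by
      rw [← hΩ, TopologicalSpace.Opens.coe_iSup]
    suffices ∀ᵐ x ∂(volume.restrict (⋃ j, (Ωs j : Set (Fin n → ℂ)))), u x = g (i x) x by
      rwa [← hset] at this
    rw [ae_restrict_iUnion_iff]
    intro j
    filter_upwards [hge j, ae_restrict_mem (Ωs j).isOpen.measurableSet] with x h1 h2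
    exact h1.trans (hG j h2).symm

/-- The cross term is `K^V_z` evaluated at `z` by the reproducing property of `K^U_z`, that is
`‖K^V_z‖²`; expanding the square leaves the difference. -/
theorem norm_sub_extendLp_kernelFun_sq {U V : TopologicalSpace.Opens (Fin n → ℂ)} (h : V ≤ Ω)
    (hUV : U ≤ V) (z : U) :
    ‖extendLp (hUV.trans h) (kernelFun z) - extendLp h (kernelFun (⟨z, hUV z.2⟩ : V))‖ ^ 2 =
      ‖kernelFun z‖ ^ 2 - ‖kernelFun (⟨z, hUV z.2⟩ : V)‖ ^ 2 := by
  have h1 : inner ℂ (extendLp (hUV.trans h) (kernelFun z))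
      (extendLp h (kernelFun (⟨z, hUV z.2⟩ : V))) =
      ((‖kernelFun (⟨z, hUV z.2⟩ : V)‖ ^ 2 : ℝ) : ℂ) := by
    rw [inner_extendLp_extendLp, inner_kernelFun, pointEval_restriction]
    exact bergmanKernel_self _
  rw [norm_sub_sq (𝕜 := ℂ), h1, norm_extendLp, norm_extendLp]
  simp only [RCLike.re_to_complex, Complex.ofReal_re]
  ring

/-- Ramadanov's theorem on the diagonal. -/
theorem tendsto_norm_kernelFun_sq {Ωs : ℕ → TopologicalSpace.Opens (Fin n → ℂ)}
    (hmono : Monotone Ωs) (hΩ : ⨆ j, Ωs j = Ω) {z : Fin n → ℂ} (hz : ∀ j, z ∈ Ωs j)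
    (hzΩ : z ∈ Ω) :
    Tendsto (fun j => ‖kernelFun (⟨z, hz j⟩ : Ωs j)‖ ^ 2) atTop
      (𝓝 (‖kernelFun (⟨z, hzΩ⟩ : Ω)‖ ^ 2)) := by
  have hle : ∀ j, Ωs j ≤ Ω := fun j => (le_iSup Ωs j).trans_eq hΩ
  set a : ℕ → ℝ := fun j => ‖kernelFun (⟨z, hz j⟩ : Ωs j)‖ ^ 2 with ha
  set v : ℕ → Lp ℂ 2 (volume.restrict (Ω : Set (Fin n → ℂ))) :=
    fun j => extendLp (hle j) (kernelFun (⟨z, hz j⟩ : Ωs j)) with hv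
  have hanti : Antitone a := fun j k hjk =>
    pow_le_pow_left₀ (norm_nonneg _) (norm_kernelFun_le (hmono hjk) ⟨z, hz j⟩) 2
  have hconv := tendsto_atTop_ciInf hanti ⟨0, by rintro _ ⟨j, rfl⟩; positivity⟩
  have hcau : CauchySeq v := by
    refine Metric.cauchySeq_iff'.2 fun ε hε => ?_
    obtain ⟨N, hN⟩ := Metric.cauchySeq_iff'.1 hconv.cauchySeq (ε ^ 2) (by positivity)
    refine ⟨N, fun k hk => lt_of_pow_lt_pow_left₀ 2 hε.le ?_⟩
    have h1 := norm_sub_extendLp_kernelFun_sq (hle k) (hmono hk) ⟨z, hz N⟩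
    rw [dist_comm, dist_eq_norm]
    refine lt_of_eq_of_lt h1 (lt_of_le_of_lt (le_abs_self _) ?_)
    have h2 := hN k hk
    rwa [dist_comm, Real.dist_eq] at h2
  obtain ⟨u, hu⟩ := cauchySeq_tendsto_of_complete hcau
  have hmem : u ∈ bergmanSpace Ω := by
    refine mem_bergmanSpace_of_forall hmono hΩ fun j => ?_
    -- On `Ωs j`, all `v k` with `k ≥ j` are holomorphic, and `A²(Ωs j)` is closed in `L²(Ωs j)`.
    have h1 := ((lpMono (Measure.restrict_mono_set volume (hle j))).continuous.tendsto u).comp hu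
    refine bergmanSpace_isClosed.mem_of_tendsto h1 ?_
    filter_upwards [eventually_ge_atTop j] with k hk
    exact ⟨rep (kernelFun (⟨z, hz k⟩ : Ωs k)), (rep_differentiableOn _).mono (hmono hk),
      (lpMono_ae _ _).trans (extendLp_ae_restrict (hle k) (hmono hk) _)⟩
  have hker : (⟨u, hmem⟩ : bergmanSpace Ω) = kernelFun ⟨z, hzΩ⟩ := by
    refine ext_inner_right ℂ fun f => ?_
    refine Eq.trans ?_ (inner_kernelFun ⟨z, hzΩ⟩ f).symm
    -- Each pairing of `v j` with `f` equals `f(z)`, so the limit `u` also reproduces the value at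
    -- `z`.
    have h1 : Tendsto (fun j => inner ℂ (v j)
        (f : Lp ℂ 2 (volume.restrict (Ω : Set (Fin n → ℂ))))) atTop
        (𝓝 (inner ℂ u (f : Lp ℂ 2 (volume.restrict (Ω : Set (Fin n → ℂ)))))) :=
      hu.inner tendsto_const_nhds
    refine tendsto_nhds_unique h1 (tendsto_const_nhds.congr fun j => ?_)
    rw [hv, inner_extendLp_coe, inner_kernelFun, pointEval_restriction]
  have hnorm : ‖u‖ = ‖kernelFun (⟨z, hzΩ⟩ : Ω)‖ := by rw [← hker]; rfl
  rw [← hnorm]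
  refine (hu.norm.pow 2).congr fun j => ?_
  rw [hv, norm_extendLp]

/-! ### Zero extensions and the kernel on the diagonal -/

theorem zeroExt_of_mem (f : Ω → ℂ) {z : Fin n → ℂ} (hz : z ∈ Ω) : zeroExt f z = f ⟨z, hz⟩ :=
  Subtype.val_injective.extend_apply f 0 ⟨z, hz⟩

theorem zeroExt_of_notMem (f : Ω → ℂ) {z : Fin n → ℂ} (hz : z ∉ Ω) : zeroExt f z = 0 :=
  Function.extend_apply' (f := (Subtype.val : Ω → Fin n → ℂ)) f 0 z
    fun ⟨w, hw⟩ => hz (hw ▸ w.2)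

theorem norm_zeroExt_le {f : Ω → ℂ} {C : ℝ} (hC : 0 ≤ C) (h : ∀ z, ‖f z‖ ≤ C)
    (z : Fin n → ℂ) : ‖zeroExt f z‖ ≤ C := by
  by_cases hz : z ∈ Ω
  · rw [zeroExt_of_mem f hz]
    exact h _
  · rwa [zeroExt_of_notMem f hz, norm_zero]

theorem measurable_zeroExt {f : Ω → ℂ} (hf : Measurable f) : Measurable (zeroExt f) :=
  (MeasurableEmbedding.subtype_coe Ω.isOpen.measurableSet).measurable_extend hf
    measurable_zero

theorem measurable_berezin (T : bergmanSpace Ω →L[ℂ] bergmanSpace Ω) :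
    Measurable (berezin T) := by
  have h1 : Continuous fun z : Ω => ((‖kernelFun z‖ ^ 2 : ℝ) : ℂ) :=
    Complex.continuous_ofReal.comp (continuous_kernelFun.norm.pow 2)
  have h2 : Continuous fun z : Ω => (inner ℂ (kernelFun z) (T (kernelFun z)) : ℂ) :=
    Continuous.inner (𝕜 := ℂ) continuous_kernelFun (T.continuous.comp continuous_kernelFun)
  have h3 : berezin T = fun z =>
      ((‖kernelFun z‖ ^ 2 : ℝ) : ℂ)⁻¹ * inner ℂ (kernelFun z) (T (kernelFun z)) :=
    funext (berezin_eq T)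
  rw [h3]
  exact h1.measurable.inv.mul h2.measurable

/-- The function `z ↦ K(z, z)` on `Ω`, extended by zero. -/
noncomputable def kernelDiag (Ω : TopologicalSpace.Opens (Fin n → ℂ)) : (Fin n → ℂ) → ℝ :=
  Function.extend Subtype.val (fun z : Ω => ‖kernelFun z‖ ^ 2) 0

theorem kernelDiag_of_mem {z : Fin n → ℂ} (hz : z ∈ Ω) :
    kernelDiag Ω z = ‖kernelFun (⟨z, hz⟩ : Ω)‖ ^ 2 :=
  Subtype.val_injective.extend_apply (fun z : Ω => ‖kernelFun z‖ ^ 2) 0 ⟨z, hz⟩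

theorem kernelDiag_nonneg {z : Fin n → ℂ} (hz : z ∈ Ω) : 0 ≤ kernelDiag Ω z := by
  rw [kernelDiag_of_mem hz]
  positivity

theorem continuousOn_kernelDiag : ContinuousOn (kernelDiag Ω) Ω := by
  rw [continuousOn_iff_continuous_domRestrict]
  have h : Set.domRestrict (Ω : Set (Fin n → ℂ)) (kernelDiag Ω) = fun z : Ω => ‖kernelFun z‖ ^ 2 :=
    funext fun z => kernelDiag_of_mem z.2
  rw [h]
  exact continuous_kernelFun.norm.pow 2

theorem kernelDiag_anti {U : TopologicalSpace.Opens (Fin n → ℂ)} (h : U ≤ Ω) {z : Fin n → ℂ}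
    (hz : z ∈ U) : kernelDiag Ω z ≤ kernelDiag U z := by
  rw [kernelDiag_of_mem hz, kernelDiag_of_mem (h hz)]
  exact pow_le_pow_left₀ (norm_nonneg _) (norm_kernelFun_le h ⟨z, hz⟩) 2

theorem mem_kernelZeroSet_iff {z : Fin n → ℂ} (hz : z ∈ Ω) :
    z ∈ kernelZeroSet Ω ↔ kernelDiag Ω z = 0 := by
  have : z ∈ kernelZeroSet Ω ↔ bergmanKernel Ω ⟨z, hz⟩ ⟨z, hz⟩ = 0 :=
    ⟨fun ⟨_, h⟩ => h, fun h => ⟨hz, h⟩⟩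
  rw [this, bergmanKernel_self, kernelDiag_of_mem hz, Complex.ofReal_eq_zero]

theorem kernelDiag_pos {z : Fin n → ℂ} (hz : z ∈ (Ω : Set (Fin n → ℂ)) \ kernelZeroSet Ω) :
    0 < kernelDiag Ω z :=
  (kernelDiag_nonneg hz.1).lt_of_ne' ((mem_kernelZeroSet_iff hz.1).not.1 hz.2)

theorem zeroExt_berezin_compression {U : TopologicalSpace.Opens (Fin n → ℂ)} (h : U ≤ Ω)
    (T : bergmanSpace Ω →L[ℂ] bergmanSpace Ω) {z : Fin n → ℂ} (hz : z ∈ U) :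
    zeroExt (berezin (compression h T)) z =
      ((kernelDiag Ω z / kernelDiag U z : ℝ) : ℂ) * zeroExt (berezin T) z := by
  rw [zeroExt_of_mem _ hz, zeroExt_of_mem _ (h hz), kernelDiag_of_mem hz,
    kernelDiag_of_mem (h hz), berezin_compression_eq_div]

/-- The convention `0⁻¹ = 0` decides the value here. It makes pointwise convergence hold on all of
`Ω`, zeros of the kernel included. -/
theorem zeroExt_berezin_eq_zero (T : bergmanSpace Ω →L[ℂ] bergmanSpace Ω) {z : Fin n → ℂ}
    (hz : z ∈ Ω) (h : kernelDiag Ω z = 0) : zeroExt (berezin T) z = 0 := by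
  rw [kernelDiag_of_mem hz] at h
  rw [zeroExt_of_mem _ hz, berezin_eq, h]
  simp

/-! ### Convergence along the exhaustion -/

section Exhaustion

variable {Ωs : ℕ → TopologicalSpace.Opens (Fin n → ℂ)}

theorem tendsto_kernelDiag (hmono : Monotone Ωs) (hΩ : ⨆ j, Ωs j = Ω) {z : Fin n → ℂ}
    (hz : z ∈ Ω) : Tendsto (fun j => kernelDiag (Ωs j) z) atTop (𝓝 (kernelDiag Ω z)) := by
  obtain ⟨J, hJ⟩ : ∃ J, z ∈ Ωs J := by rwa [← hΩ, TopologicalSpace.Opens.mem_iSup] at hz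
  have hJ' : ∀ j, z ∈ Ωs (j + J) := fun j => hmono (Nat.le_add_left J j) hJ
  rw [← tendsto_add_atTop_iff_nat J, kernelDiag_of_mem hz]
  -- Dropping the first `J` sets puts `z` in every member of the sequence without changing the
  -- union.
  refine (tendsto_norm_kernelFun_sq (Ωs := fun j => Ωs (j + J))
    (fun i j hij => hmono (Nat.add_le_add_right hij J)) ((hmono.iSup_nat_add J).trans hΩ)
    hJ' hz).congr fun j => ?_
  rw [kernelDiag_of_mem (hJ' j)]

theorem tendsto_kernelDiag_div (hmono : Monotone Ωs) (hΩ : ⨆ j, Ωs j = Ω) {z : Fin n → ℂ}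
    (hz : z ∈ Ω) (hz0 : kernelDiag Ω z ≠ 0) :
    Tendsto (fun j => kernelDiag Ω z / kernelDiag (Ωs j) z) atTop (𝓝 1) := by
  have := (tendsto_const_nhds (x := kernelDiag Ω z)).div (tendsto_kernelDiag hmono hΩ hz) hz0
  rwa [div_self hz0] at this

theorem tendsto_zeroExt_berezin_compression (hmono : Monotone Ωs) (hΩ : ⨆ j, Ωs j = Ω)
    (T : bergmanSpace Ω →L[ℂ] bergmanSpace Ω) {z : Fin n → ℂ} (hz : z ∈ Ω) :
    Tendsto (fun j => zeroExt (berezin (compression ((le_iSup Ωs j).trans_eq hΩ) T)) z) atTop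
      (𝓝 (zeroExt (berezin T) z)) := by
  obtain ⟨J, hJ⟩ : ∃ J, z ∈ Ωs J := by rwa [← hΩ, TopologicalSpace.Opens.mem_iSup] at hz
  have hev : ∀ᶠ j in atTop, ((kernelDiag Ω z / kernelDiag (Ωs j) z : ℝ) : ℂ) *
      zeroExt (berezin T) z =
        zeroExt (berezin (compression ((le_iSup Ωs j).trans_eq hΩ) T)) z := by
    filter_upwards [eventually_ge_atTop J] with j hj
    exact (zeroExt_berezin_compression _ T (hmono hj hJ)).symm
  refine Tendsto.congr' hev ?_
  by_cases h0 : kernelDiag Ω z = 0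
  · simp [zeroExt_berezin_eq_zero T hz h0]
  · have := ((Complex.continuous_ofReal.tendsto 1).comp
      (tendsto_kernelDiag_div hmono hΩ hz h0)).mul_const (zeroExt (berezin T) z)
    simpa using this

theorem exists_subset_of_isCompact (hmono : Monotone Ωs) (hΩ : ⨆ j, Ωs j = Ω)
    {K : Set (Fin n → ℂ)} (hK : IsCompact K) (hKΩ : K ⊆ Ω) :
    ∃ J, K ⊆ (Ωs J : Set (Fin n → ℂ)) := by
  refine hK.elim_directed_cover (fun j => (Ωs j : Set (Fin n → ℂ))) (fun j => (Ωs j).isOpen) ?_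
    (hmono.directed_le)
  rwa [← hΩ, TopologicalSpace.Opens.coe_iSup] at hKΩ

theorem subset_diff_kernelZeroSet {U : TopologicalSpace.Opens (Fin n → ℂ)} (h : U ≤ Ω)
    {K : Set (Fin n → ℂ)} (hK : K ⊆ (Ω : Set (Fin n → ℂ)) \ kernelZeroSet Ω)
    (hKU : K ⊆ U) : K ⊆ (U : Set (Fin n → ℂ)) \ kernelZeroSet U := by
  refine fun z hz => ⟨hKU hz, ?_⟩
  rw [mem_kernelZeroSet_iff (hKU hz)]
  exact ((kernelDiag_pos (hK hz)).trans_le (kernelDiag_anti h (hKU hz))).ne'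

/-- Dini's theorem: the denominators decrease in `j`, so these continuous quotients increase to the
constant `1` on a compact set. -/
theorem tendstoUniformlyOn_kernelDiag_div (hmono : Monotone Ωs) (hΩ : ⨆ j, Ωs j = Ω)
    {K : Set (Fin n → ℂ)} (hK : IsCompact K)
    (hKΩ : K ⊆ (Ω : Set (Fin n → ℂ)) \ kernelZeroSet Ω) (hsub : ∀ j, K ⊆ Ωs j) :
    TendstoUniformlyOn (fun j z => kernelDiag Ω z / kernelDiag (Ωs j) z) (fun _ => 1) atTop K := by
  have hle : ∀ j, Ωs j ≤ Ω := fun j => (le_iSup Ωs j).trans_eq hΩ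
  have hpos : ∀ j, ∀ z ∈ K, 0 < kernelDiag (Ωs j) z := fun j z hz =>
    kernelDiag_pos (subset_diff_kernelZeroSet (hle j) hKΩ (hsub j) hz)
  refine Monotone.tendstoUniformlyOn_of_forall_tendsto hK (fun j => ?_) (fun z hz i j hij => ?_)
    continuousOn_const fun z hz =>
      tendsto_kernelDiag_div hmono hΩ (hKΩ hz).1 (kernelDiag_pos (hKΩ hz)).ne'
  · exact (continuousOn_kernelDiag.mono fun z hz => (hKΩ hz).1).div
      (continuousOn_kernelDiag.mono (hsub j)) fun z hz => (hpos j z hz).ne'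
  · exact div_le_div_of_nonneg_left (kernelDiag_pos (hKΩ hz)).le (hpos j z hz)
      (kernelDiag_anti (hmono hij) (hsub i hz))

theorem tendstoUniformlyOn_zeroExt_berezin_compression (hmono : Monotone Ωs)
    (hΩ : ⨆ j, Ωs j = Ω) (T : bergmanSpace Ω →L[ℂ] bergmanSpace Ω) {K : Set (Fin n → ℂ)}
    (hK : IsCompact K) (hKΩ : K ⊆ (Ω : Set (Fin n → ℂ)) \ kernelZeroSet Ω) :
    TendstoUniformlyOn
      (fun j => zeroExt (berezin (compression ((le_iSup Ωs j).trans_eq hΩ) T)))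
      (zeroExt (berezin T)) atTop K := by
  obtain ⟨J, hJ⟩ := exists_subset_of_isCompact hmono hΩ hK fun z hz => (hKΩ hz).1
  have hunif := tendstoUniformlyOn_kernelDiag_div (Ωs := fun j => Ωs (j + J))
    (fun i j hij => hmono (Nat.add_le_add_right hij J)) ((hmono.iSup_nat_add J).trans hΩ) hK hKΩ
    fun j => hJ.trans (hmono (Nat.le_add_left J j))
  rw [Metric.tendstoUniformlyOn_iff] at hunif ⊢
  intro ε hε
  -- The error is `|1 - ρ| * |B_Ω T|` with `|B_Ω T| ≤ ‖T‖`; adding `1` keeps the divisor positive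
  -- when `T = 0`.
  obtain ⟨N, hN⟩ := eventually_atTop.1 (hunif (ε / (‖T‖ + 1)) (by positivity))
  filter_upwards [eventually_ge_atTop (N + J)] with j hj z hz
  have h1 := hN (j - J) (by omega) z hz
  rw [Nat.sub_add_cancel (by omega : J ≤ j), Real.dist_eq] at h1
  rw [zeroExt_berezin_compression _ T (hmono (by omega : J ≤ j) (hJ hz)), dist_eq_norm]
  set ρ := kernelDiag Ω z / kernelDiag (Ωs j) z
  set b := zeroExt (berezin T) z with hb
  have h2 : b - (ρ : ℂ) * b = ((1 - ρ : ℝ) : ℂ) * b := by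
    push_cast
    ring
  have h3 : ‖b‖ ≤ ‖T‖ := norm_zeroExt_le (norm_nonneg T) (norm_berezin_le T) z
  rw [h2, norm_mul, Complex.norm_real, Real.norm_eq_abs]
  rw [lt_div_iff₀ (by positivity)] at h1
  nlinarith [abs_nonneg (1 - ρ)]

end Exhaustion

/-! ### Convergence in `L^p` on bounded domains -/

theorem memLp_zeroExt_of_bound {U V : TopologicalSpace.Opens (Fin n → ℂ)}
    (hV : Bornology.IsBounded (V : Set (Fin n → ℂ))) {f : U → ℂ} (hf : Measurable f) {C : ℝ}
    (hC : 0 ≤ C) (h : ∀ z, ‖f z‖ ≤ C) (p : ENNReal) :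
    MemLp (zeroExt f) p (volume.restrict (V : Set (Fin n → ℂ))) := by
  have : IsFiniteMeasure (volume.restrict (V : Set (Fin n → ℂ))) :=
    isFiniteMeasure_restrict.2 hV.measure_lt_top.ne
  exact MemLp.of_bound (measurable_zeroExt hf).aestronglyMeasurable C
    (ae_of_all _ (norm_zeroExt_le hC h))

/-- Bounded convergence in `L^p`, for `0 < p < ∞` and a finite measure. -/
theorem tendsto_eLpNorm_sub_of_bounded {α E : Type*} {m : MeasurableSpace α} {μ : Measure α}
    [IsFiniteMeasure μ] [NormedAddCommGroup E] {f : ℕ → α → E} {g : α → E} {C : ℝ}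
    (hf : ∀ j, AEStronglyMeasurable (f j) μ) (hg : AEStronglyMeasurable g μ)
    (hfC : ∀ j x, ‖f j x‖ ≤ C) (hgC : ∀ x, ‖g x‖ ≤ C)
    (hlim : ∀ᵐ x ∂μ, Tendsto (fun j => f j x) atTop (𝓝 (g x)))
    {p : ENNReal} (hp0 : p ≠ 0) (hp : p ≠ ⊤) :
    Tendsto (fun j => eLpNorm (f j - g) p μ) atTop (𝓝 0) := by
  have hp' : 0 < p.toReal := ENNReal.toReal_pos hp0 hp
  -- Dominated convergence is applied to the `p`-th powers, with only a pointwise triangle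
  -- inequality, so `p < 1` needs no separate treatment.
  have h1 : Tendsto (fun j => ∫⁻ x, ‖(f j - g) x‖ₑ ^ p.toReal ∂μ) atTop (𝓝 (∫⁻ _, 0 ∂μ)) := by
    refine tendsto_lintegral_of_dominated_convergence'
      (fun _ => ENNReal.ofReal (C + C) ^ p.toReal) (fun j => ((hf j).sub hg).enorm.pow_const _)
      (fun j => ae_of_all _ fun x => ?_) ?_ ?_
    · refine ENNReal.rpow_le_rpow ?_ hp'.le
      rw [← ofReal_norm]
      exact ENNReal.ofReal_le_ofReal ((norm_sub_le _ _).trans (add_le_add (hfC j x) (hgC x)))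
    · rw [lintegral_const]
      exact ENNReal.mul_ne_top (ENNReal.rpow_ne_top_of_nonneg hp'.le ENNReal.ofReal_ne_top)
        (measure_ne_top _ _)
    · filter_upwards [hlim] with x hx
      have h2 : Tendsto (fun j => ‖(f j - g) x‖ₑ) atTop (𝓝 ‖g x - g x‖ₑ) :=
        (hx.sub_const (g x)).enorm
      have h3 := ((ENNReal.continuous_rpow_const (y := p.toReal)).tendsto _).comp h2
      simpa [hp', Function.comp_def] using h3
  have h4 := ((ENNReal.continuous_rpow_const (y := 1 / p.toReal)).tendsto _).comp h1
  simp only [eLpNorm_eq_lintegral_rpow_enorm_toReal hp0 hp]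
  simpa [hp', Function.comp_def] using h4

end Bergman

/-! ### The main theorem -/

theorem mainTheorem1 {n : ℕ} (Ωs : ℕ → TopologicalSpace.Opens (Fin n → ℂ))
    (Ω : TopologicalSpace.Opens (Fin n → ℂ))
    (hdom : ∀ j, IsConnected (Ωs j : Set (Fin n → ℂ)))
    (hmono : ∀ j, Ωs j ≤ Ωs (j + 1))
    (hΩ : ⨆ j, Ωs j = Ω)
    (hnt : Bergman.IsNontrivialBergmanDomain Ω)
    (T : Bergman.bergmanSpace Ω →L[ℂ] Bergman.bergmanSpace Ω) :
    (∀ K : Set (Fin n → ℂ), IsCompact K →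
      K ⊆ (Ω : Set (Fin n → ℂ)) \ Bergman.kernelZeroSet Ω →
        (∀ᶠ j in atTop, K ⊆ (Ωs j : Set (Fin n → ℂ)) \ Bergman.kernelZeroSet (Ωs j)) ∧
        TendstoUniformlyOn (fun j => Bergman.zeroExt (Bergman.berezin
            (Bergman.compression ((le_iSup Ωs j).trans_eq hΩ) T)))
          (Bergman.zeroExt (Bergman.berezin T)) atTop K) ∧
    (Bornology.IsBounded (Ω : Set (Fin n → ℂ)) →
      ∀ p : ENNReal, p ≠ 0 → p ≠ ⊤ →
        (∀ j, MemLp (Bergman.zeroExt (Bergman.berezin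
            (Bergman.compression ((le_iSup Ωs j).trans_eq hΩ) T))) p
          (volume.restrict (Ω : Set (Fin n → ℂ)))) ∧
        MemLp (Bergman.zeroExt (Bergman.berezin T)) p
          (volume.restrict (Ω : Set (Fin n → ℂ))) ∧
        Tendsto (fun j => eLpNorm (Bergman.zeroExt (Bergman.berezin
            (Bergman.compression ((le_iSup Ωs j).trans_eq hΩ) T)) -
              Bergman.zeroExt (Bergman.berezin T)) p
          (volume.restrict (Ω : Set (Fin n → ℂ)))) atTop (𝓝 0)) := by
  have hM : Monotone Ωs := monotone_nat_of_le_succ hmono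
  refine ⟨fun K hK hKΩ => ⟨?_,
    Bergman.tendstoUniformlyOn_zeroExt_berezin_compression hM hΩ T hK hKΩ⟩,
    fun hb p hp0 hp => ?_⟩
  · obtain ⟨J, hJ⟩ := Bergman.exists_subset_of_isCompact hM hΩ hK fun z hz => (hKΩ hz).1
    filter_upwards [eventually_ge_atTop J] with j hj
    exact Bergman.subset_diff_kernelZeroSet ((le_iSup Ωs j).trans_eq hΩ) hKΩ
      (hJ.trans (hM hj))
  · have hj := fun j => Bergman.memLp_zeroExt_of_bound hb
      (Bergman.measurable_berezin (Bergman.compression ((le_iSup Ωs j).trans_eq hΩ) T))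
      (norm_nonneg T) (Bergman.norm_berezin_compression_le _ T) p
    have h := Bergman.memLp_zeroExt_of_bound hb (Bergman.measurable_berezin T)
      (norm_nonneg T) (Bergman.norm_berezin_le T) p
    have : IsFiniteMeasure (volume.restrict (Ω : Set (Fin n → ℂ))) :=
      isFiniteMeasure_restrict.2 hb.measure_lt_top.ne
    refine ⟨hj, h, Bergman.tendsto_eLpNorm_sub_of_bounded (fun j => (hj j).1) h.1
      (fun j => Bergman.norm_zeroExt_le (norm_nonneg T) (Bergman.norm_berezin_compression_le _ T))
      (Bergman.norm_zeroExt_le (norm_nonneg T) (Bergman.norm_berezin_le T)) ?_ hp0 hp⟩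
    filter_upwards [ae_restrict_mem Ω.isOpen.measurableSet] with z hz
    exact Bergman.tendsto_zeroExt_berezin_compression hM hΩ T hz
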